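/- Let $|\Psi\rangle \in \mathcal H_A\otimes\mathcal H_B\otimes\mathcal H_C$ with $\mathcal H_A=\mathcal H_B=\mathcal H_C=\mathbb C^2$ be a three-qubit pure state, i.e. a vector with $\langle\Psi|\Psi\rangle=1$. Put $\rho_{AB}=\operatorname{Tr}_C|\Psi\rangle\langle\Psi|$, $\rho_A=\operatorname{Tr}_B\rho_{AB}$, $\rho_B=\operatorname{Tr}_A\rho_{AB}$, and $$\phi_{ABC}=69-\operatorname{Tr}\big[(2\rho_{AB}+\rho_A\otimes I_B+I_A\otimes\rho_B)^3\big]-3\operatorname{Tr}(\rho_{AB}^2).$$ Then $\phi_{ABC}\le 99/2$. Equality holds if and only if $|\Psi\rangle$ is LU-equivalent to the GHZ state $|\mathrm{GHZ}\rangle=(|000\rangle+|111\rangle)/\sqrt2$, that is, if and only if there are unitary $2\times2$ matrices $U,V,W$ with $|\Psi\rangle=(U\otimes V\otimes W)|\mathrm{GHZ}\rangle$. -/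

import Mathlib

open scoped Matrix Kronecker

namespace ThreeQubit

/-- The Hilbert space `ℂ² ⊗ ℂ² ⊗ ℂ²` of three qubits `A`, `B`, `C`, in coordinates with respect to
the computational basis `|jkl⟩`, `j, k, l ∈ {0, 1}`. A pure state is a vector of norm `1`. -/
abbrev Space : Type := EuclideanSpace ℂ (Fin 2 × Fin 2 × Fin 2)

/-- The computational basis vector `|jkl⟩`. -/
noncomputable def ket (j k l : Fin 2) : Space := EuclideanSpace.single (j, k, l) (1 : ℂ)

/-- The GHZ state `(|000⟩ + |111⟩) / √2`. -/
noncomputable def ghz : Space := ((1 / Real.sqrt 2 : ℝ) : ℂ) • (ket 0 0 0 + ket 1 1 1)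

/-- The projector `|ψ⟩⟨ψ|`. -/
noncomputable def rhoABC (ψ : Space) :
    Matrix (Fin 2 × Fin 2 × Fin 2) (Fin 2 × Fin 2 × Fin 2) ℂ :=
  Matrix.of fun x y => ψ x * star (ψ y)

/-- The reduced density matrix `ρ_AB = Tr_C |ψ⟩⟨ψ|`. -/
noncomputable def rhoAB (ψ : Space) : Matrix (Fin 2 × Fin 2) (Fin 2 × Fin 2) ℂ :=
  Matrix.of fun x y => ∑ c, rhoABC ψ (x.1, x.2, c) (y.1, y.2, c)

/-- The reduced density matrix `ρ_A = Tr_B ρ_AB`. -/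
noncomputable def rhoA (ψ : Space) : Matrix (Fin 2) (Fin 2) ℂ :=
  Matrix.of fun a a' => ∑ b, rhoAB ψ (a, b) (a', b)

/-- The reduced density matrix `ρ_B = Tr_A ρ_AB`. -/
noncomputable def rhoB (ψ : Space) : Matrix (Fin 2) (Fin 2) ℂ :=
  Matrix.of fun b b' => ∑ a, rhoAB ψ (a, b) (a, b')

/-- The operator `2 ρ_AB + ρ_A ⊗ I_B + I_A ⊗ ρ_B`. -/
noncomputable def sumOp (ψ : Space) : Matrix (Fin 2 × Fin 2) (Fin 2 × Fin 2) ℂ :=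
  (2 : ℂ) • rhoAB ψ + rhoA ψ ⊗ₖ (1 : Matrix (Fin 2) (Fin 2) ℂ)
    + (1 : Matrix (Fin 2) (Fin 2) ℂ) ⊗ₖ rhoB ψ

/-- `φ_ABC = 69 - Tr[(2 ρ_AB + ρ_A ⊗ I_B + I_A ⊗ ρ_B)³] - 3 Tr[ρ_AB²]`. Both traces are real
numbers (see `ofReal_phi`), so taking real parts loses nothing. -/
noncomputable def phi (ψ : Space) : ℝ :=
  69 - (Matrix.trace (sumOp ψ ^ 3)).re - 3 * (Matrix.trace (rhoAB ψ ^ 2)).re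

theorem rhoAB_isHermitian (ψ : Space) : (rhoAB ψ).IsHermitian := by
  ext x y
  simp [rhoAB, rhoABC, Matrix.conjTranspose_apply, mul_comm]

theorem rhoA_isHermitian (ψ : Space) : (rhoA ψ).IsHermitian := by
  ext a a'
  simp only [rhoA, Matrix.conjTranspose_apply, Matrix.of_apply, star_sum]
  exact Finset.sum_congr rfl fun b _ => (rhoAB_isHermitian ψ).apply _ _

theorem rhoB_isHermitian (ψ : Space) : (rhoB ψ).IsHermitian := by
  ext b b'
  simp only [rhoB, Matrix.conjTranspose_apply, Matrix.of_apply, star_sum]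
  exact Finset.sum_congr rfl fun a _ => (rhoAB_isHermitian ψ).apply _ _

theorem sumOp_isHermitian (ψ : Space) : (sumOp ψ).IsHermitian := by
  have h1 := (rhoAB_isHermitian ψ).eq
  have h2 := (rhoA_isHermitian ψ).eq
  have h3 := (rhoB_isHermitian ψ).eq
  simp [Matrix.IsHermitian, sumOp, Matrix.conjTranspose_kronecker, h1, h2, h3]

theorem ofReal_re_trace {n : Type} [Fintype n] {M : Matrix n n ℂ} (h : M.IsHermitian) :
    ((Matrix.trace M).re : ℂ) = Matrix.trace M := by
  have : star (Matrix.trace M) = Matrix.trace M := by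
    rw [← Matrix.trace_conjTranspose, h.eq]
  exact Complex.conj_eq_iff_re.mp this

/-- `φ_ABC` agrees with the same expression evaluated in `ℂ`. -/
theorem ofReal_phi (ψ : Space) :
    (phi ψ : ℂ) = 69 - Matrix.trace (sumOp ψ ^ 3) - 3 * Matrix.trace (rhoAB ψ ^ 2) := by
  have h1 := ofReal_re_trace ((sumOp_isHermitian ψ).pow 3)
  have h2 := ofReal_re_trace ((rhoAB_isHermitian ψ).pow 2)
  rw [← h1, ← h2]
  simp [phi]

/-- Local unitary equivalence: `ψ = (U ⊗ V ⊗ W) χ` for one-qubit unitaries `U`, `V`, `W`.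
Since they range over the full unitary group `U(2)`, a global phase is included. -/
def LUEquiv (ψ χ : Space) : Prop :=
  ∃ U ∈ Matrix.unitaryGroup (Fin 2) ℂ, ∃ V ∈ Matrix.unitaryGroup (Fin 2) ℂ,
    ∃ W ∈ Matrix.unitaryGroup (Fin 2) ℂ,
      ψ = WithLp.toLp 2 ((U ⊗ₖ (V ⊗ₖ W)) *ᵥ χ.ofLp)

end ThreeQubit

namespace ThreeQubit

/-! Write each one-qubit marginal as half the identity plus a traceless Hermitian deviation `α`,
`β`, `γ` (on C, the conjugate marginal `gramC` serves). Every such 2×2 deviation squares to a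
scalar. With `a`, `b`, `c` the traces of `α²`, `β²`, `γ²`, expanding the cube turns the quantity
subtracted from 69 into `39/2 + 27(a+b+c)` plus 12 times the sum of the three pairwise correlators
of the deviations (`trace_sumOp_pow_add`). The expectation of the square of a sum of two deviations
is nonnegative, so the AB correlator is at least `-(a+b)/4`, and likewise for AC and BC. Hence `φ ≤
99/2 - 21(a+b+c)` (`phi_le`), with equality to `99/2` exactly when all three marginals are maximally
mixed.

Such states form the LU orbit of GHZ. A unitary on A can make the `|0⟩`-slice singular, since its
determinant is a binary quadratic form in the first row of the unitary. Unitaries on B and C then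
reduce the slice to a multiple of `|00⟩`, and the marginal conditions leave only `|000⟩` and `|111⟩`
(`MaximallyMixedMarginals.luEquiv_ghz`). -/

/-! ### Marginals and their traceless deviations -/

/-- The coefficients of `ψ` as a linear map from qubit `C` to the qubits `A` and `B`. -/
noncomputable def coeffAB (ψ : Space) : Matrix (Fin 2 × Fin 2) (Fin 2) ℂ :=
  Matrix.of fun x c => ψ (x.1, x.2, c)

/-- The Gram matrix of `coeffAB ψ`, which is the complex conjugate of `ρ_C`. -/
noncomputable def gramC (ψ : Space) : Matrix (Fin 2) (Fin 2) ℂ :=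
  (coeffAB ψ)ᴴ * coeffAB ψ

theorem rhoAB_eq_mul (ψ : Space) : rhoAB ψ = coeffAB ψ * (coeffAB ψ)ᴴ := by
  ext x y
  simp [rhoAB, rhoABC, coeffAB, Matrix.mul_apply]

theorem gramC_isHermitian (ψ : Space) : (gramC ψ).IsHermitian :=
  Matrix.isHermitian_conjTranspose_mul_self _

theorem trace_rhoAB_mul_kronecker_one (ψ : Space) (X : Matrix (Fin 2) (Fin 2) ℂ) :
    (rhoAB ψ * (X ⊗ₖ (1 : Matrix (Fin 2) (Fin 2) ℂ))).trace = (rhoA ψ * X).trace := by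
  simp [Matrix.trace, Matrix.mul_apply, Fintype.sum_prod_type, rhoA, Matrix.one_apply]
  ring

theorem trace_rhoAB_mul_one_kronecker (ψ : Space) (X : Matrix (Fin 2) (Fin 2) ℂ) :
    (rhoAB ψ * ((1 : Matrix (Fin 2) (Fin 2) ℂ) ⊗ₖ X)).trace = (rhoB ψ * X).trace := by
  simp [Matrix.trace, Matrix.mul_apply, Fintype.sum_prod_type, rhoB, Matrix.one_apply]
  ring

theorem trace_rhoAB {ψ : Space} (hψ : ‖ψ‖ = 1) : (rhoAB ψ).trace = 1 := by
  have h : ‖ψ‖ ^ 2 = 1 := by rw [hψ]; norm_num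
  rw [EuclideanSpace.norm_sq_eq] at h
  have h' : ((∑ i, ‖ψ i‖ ^ 2 : ℝ) : ℂ) = 1 := by rw [h]; simp
  rw [← h']
  simp [Matrix.trace, rhoAB, rhoABC, Fintype.sum_prod_type, Complex.mul_conj']

theorem trace_rhoA {ψ : Space} (hψ : ‖ψ‖ = 1) : (rhoA ψ).trace = 1 := by
  have h := trace_rhoAB_mul_kronecker_one ψ 1
  rw [Matrix.one_kronecker_one, mul_one, mul_one, trace_rhoAB hψ] at h
  exact h.symm

theorem trace_rhoB {ψ : Space} (hψ : ‖ψ‖ = 1) : (rhoB ψ).trace = 1 := by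
  have h := trace_rhoAB_mul_one_kronecker ψ 1
  rw [Matrix.one_kronecker_one, mul_one, mul_one, trace_rhoAB hψ] at h
  exact h.symm

theorem trace_gramC {ψ : Space} (hψ : ‖ψ‖ = 1) : (gramC ψ).trace = 1 := by
  rw [gramC, Matrix.trace_mul_comm, ← rhoAB_eq_mul, trace_rhoAB hψ]

/-- Cayley–Hamilton for a traceless 2×2 matrix. It makes the squares in the positivity bounds reduce
to scalars and correlators. -/
theorem mul_self_of_trace_eq_zero {X : Matrix (Fin 2) (Fin 2) ℂ} (h : X.trace = 0) :
    X * X = ((X * X).trace / 2) • (1 : Matrix (Fin 2) (Fin 2) ℂ) := by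
  have h1 : X 1 1 = -X 0 0 := by
    rw [Matrix.trace_fin_two] at h
    linear_combination h
  ext i j
  fin_cases i <;> fin_cases j <;>
    simp [Matrix.trace_fin_two, Matrix.mul_apply, Fin.sum_univ_two, h1] <;> ring

/-- The deviation of a one-qubit density matrix from the maximally mixed state. -/
noncomputable def deviation (X : Matrix (Fin 2) (Fin 2) ℂ) : Matrix (Fin 2) (Fin 2) ℂ :=
  X - (1 / 2 : ℂ) • 1

theorem deviation_isHermitian {X : Matrix (Fin 2) (Fin 2) ℂ} (h : X.IsHermitian) :
    (deviation X).IsHermitian := by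
  simp [deviation, Matrix.IsHermitian, h.eq]

theorem trace_deviation {X : Matrix (Fin 2) (Fin 2) ℂ} (h : X.trace = 1) :
    (deviation X).trace = 0 := by
  simp [deviation, Matrix.trace_sub, h]

theorem eq_deviation_add (X : Matrix (Fin 2) (Fin 2) ℂ) :
    X = deviation X + (1 / 2 : ℂ) • 1 := by
  simp [deviation]

theorem trace_mul_deviation {X : Matrix (Fin 2) (Fin 2) ℂ} (h : X.trace = 1) :
    (X * deviation X).trace = (deviation X * deviation X).trace := by
  nth_rewrite 1 [eq_deviation_add X]
  simp [add_mul, Matrix.trace_add, trace_deviation h]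

theorem trace_mul_self_mul_self {X : Matrix (Fin 2) (Fin 2) ℂ} (h : X.trace = 0) :
    (X * X * X).trace = 0 := by
  rw [mul_self_of_trace_eq_zero h]
  simp [h]

theorem trace_mul_self_eq {X : Matrix (Fin 2) (Fin 2) ℂ} (h : X.trace = 1) :
    (X * X).trace = 1 / 2 + (deviation X * deviation X).trace := by
  have h0 := trace_deviation h
  nth_rewrite 1 2 [eq_deviation_add X]
  simp [add_mul, mul_add, Matrix.trace_add, h0]
  ring

theorem trace_mul_self_mul_self_eq {X : Matrix (Fin 2) (Fin 2) ℂ} (h : X.trace = 1) :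
    (X * X * X).trace = 1 / 4 + 3 / 2 * (deviation X * deviation X).trace := by
  have h0 := trace_deviation h
  have h1 := trace_mul_self_mul_self h0
  nth_rewrite 1 2 3 [eq_deviation_add X]
  simp [add_mul, mul_add, Matrix.trace_add, h0, h1]
  ring

/-! ### Correlators and expansion of the cube -/

/-- The correlator of the deviations on `A` and `B`. -/
noncomputable def corrAB (ψ : Space) : ℂ :=
  (rhoAB ψ * (deviation (rhoA ψ) ⊗ₖ deviation (rhoB ψ))).trace

/-- The correlator of the operator `X` on `AB` with the deviation on `C`. -/
noncomputable def corrC (ψ : Space) (X : Matrix (Fin 2 × Fin 2) (Fin 2 × Fin 2) ℂ) : ℂ :=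
  ((coeffAB ψ)ᴴ * X * coeffAB ψ * deviation (gramC ψ)).trace

/-- With `M = coeffAB ψ`, cyclicity moves one factor `ρ_AB = M Mᴴ` across to `Mᴴ M` on C. The terms
quadratic in `ρ_AB` thereby become correlators with C. -/
theorem trace_rhoAB_mul_self_mul (ψ : Space) (X : Matrix (Fin 2 × Fin 2) (Fin 2 × Fin 2) ℂ) :
    (rhoAB ψ * rhoAB ψ * X).trace = corrC ψ X + 1 / 2 * (rhoAB ψ * X).trace := by
  have h1 : (rhoAB ψ * rhoAB ψ * X).trace = ((coeffAB ψ)ᴴ * X * coeffAB ψ * gramC ψ).trace := by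
    rw [rhoAB_eq_mul, gramC, Matrix.trace_mul_comm _ X, ← Matrix.mul_assoc, ← Matrix.mul_assoc,
      ← Matrix.mul_assoc, Matrix.trace_mul_comm _ (coeffAB ψ)ᴴ]
    simp only [Matrix.mul_assoc]
  have h2 : (rhoAB ψ * X).trace = ((coeffAB ψ)ᴴ * X * coeffAB ψ).trace := by
    rw [rhoAB_eq_mul, Matrix.mul_assoc, Matrix.trace_mul_comm]
  rw [h1, h2, corrC, eq_deviation_add (gramC ψ)]
  simp [deviation, Matrix.mul_sub]

theorem trace_rhoAB_mul_self (ψ : Space) :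
    (rhoAB ψ * rhoAB ψ).trace = (gramC ψ * gramC ψ).trace := by
  rw [rhoAB_eq_mul, gramC, Matrix.mul_assoc, Matrix.trace_mul_comm]
  simp only [Matrix.mul_assoc]

theorem trace_rhoAB_mul_self_mul_self (ψ : Space) :
    (rhoAB ψ * rhoAB ψ * rhoAB ψ).trace = (gramC ψ * gramC ψ * gramC ψ).trace := by
  rw [rhoAB_eq_mul, gramC, Matrix.mul_assoc, Matrix.mul_assoc, Matrix.trace_mul_comm]
  simp only [Matrix.mul_assoc]

/-- Under the trace, words of degree at most three in two letters depend only on the letter counts,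
by cyclicity. -/
theorem trace_one_add_add_pow_three {n : Type*} [Fintype n] [DecidableEq n]
    (P T : Matrix n n ℂ) :
    ((1 + P + T) ^ 3).trace = (1 : Matrix n n ℂ).trace + 3 * P.trace + 3 * T.trace
      + 3 * (P * P).trace + 6 * (P * T).trace + 3 * (T * T).trace
      + (P * P * P).trace + 3 * (P * P * T).trace + 3 * (P * (T * T)).trace
      + (T * T * T).trace := by
  have e : (1 + P + T) ^ 3 = 1 + (3 : ℂ) • P + (3 : ℂ) • T + (3 : ℂ) • (P * P)
      + (3 : ℂ) • (P * T) + (3 : ℂ) • (T * P) + (3 : ℂ) • (T * T) + P * P * P + P * P * T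
      + P * T * P + T * P * P + P * T * T + T * P * T + T * T * P + T * T * T := by
    simp only [ofNat_smul_eq_nsmul ℂ]
    noncomm_ring
  rw [e]
  simp only [Matrix.trace_add, Matrix.trace_smul, smul_eq_mul]
  rw [Matrix.trace_mul_comm T P, Matrix.trace_mul_comm (P * T) P, Matrix.trace_mul_comm (T * P) T,
    Matrix.trace_mul_comm (T * T) P, mul_assoc T P P, Matrix.trace_mul_comm T (P * P),
    ← mul_assoc P P T, ← mul_assoc T T P, Matrix.trace_mul_comm (T * T) P, mul_assoc P T T]
  ring

section Trace

variable {ψ : Space}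

theorem trace_rhoAB_mul_sum (hψ : ‖ψ‖ = 1) :
    (rhoAB ψ * (deviation (rhoA ψ) ⊗ₖ (1 : Matrix (Fin 2) (Fin 2) ℂ)
      + (1 : Matrix (Fin 2) (Fin 2) ℂ) ⊗ₖ deviation (rhoB ψ))).trace
      = (deviation (rhoA ψ) * deviation (rhoA ψ)).trace
        + (deviation (rhoB ψ) * deviation (rhoB ψ)).trace := by
  rw [mul_add, Matrix.trace_add, trace_rhoAB_mul_kronecker_one, trace_rhoAB_mul_one_kronecker,
    trace_mul_deviation (trace_rhoA hψ), trace_mul_deviation (trace_rhoB hψ)]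

theorem sum_mul_sum {X Y : Matrix (Fin 2) (Fin 2) ℂ} (hX : X.trace = 0) (hY : Y.trace = 0) :
    (X ⊗ₖ (1 : Matrix (Fin 2) (Fin 2) ℂ) + (1 : Matrix (Fin 2) (Fin 2) ℂ) ⊗ₖ Y)
      * (X ⊗ₖ (1 : Matrix (Fin 2) (Fin 2) ℂ) + (1 : Matrix (Fin 2) (Fin 2) ℂ) ⊗ₖ Y)
      = (((X * X).trace + (Y * Y).trace) / 2) • (1 : Matrix (Fin 2 × Fin 2) (Fin 2 × Fin 2) ℂ)
        + (2 : ℂ) • (X ⊗ₖ Y) := by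
  simp only [mul_add, add_mul, ← Matrix.mul_kronecker_mul, one_mul, mul_one]
  rw [mul_self_of_trace_eq_zero hX, mul_self_of_trace_eq_zero hY, Matrix.smul_kronecker,
    Matrix.kronecker_smul, Matrix.one_kronecker_one]
  simp only [Matrix.trace_smul, Matrix.trace_one, Fintype.card_fin, smul_eq_mul]
  module

theorem trace_sumOp_pow_add (hψ : ‖ψ‖ = 1) :
    (sumOp ψ ^ 3).trace + 3 * (rhoAB ψ ^ 2).trace
      = 39 / 2 + 27 * ((deviation (rhoA ψ) * deviation (rhoA ψ)).trace
          + (deviation (rhoB ψ) * deviation (rhoB ψ)).trace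
          + (deviation (gramC ψ) * deviation (gramC ψ)).trace)
        + 12 * (corrAB ψ
          + corrC ψ (deviation (rhoA ψ) ⊗ₖ 1) + corrC ψ (1 ⊗ₖ deviation (rhoB ψ))) := by
  have hA := trace_deviation (trace_rhoA hψ)
  have hB := trace_deviation (trace_rhoB hψ)
  set T := deviation (rhoA ψ) ⊗ₖ (1 : Matrix (Fin 2) (Fin 2) ℂ)
      + (1 : Matrix (Fin 2) (Fin 2) ℂ) ⊗ₖ deviation (rhoB ψ) with hT
  have hS : sumOp ψ = 1 + (2 : ℂ) • rhoAB ψ + T := by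
    rw [sumOp, hT]
    nth_rewrite 1 [eq_deviation_add (rhoA ψ)]
    nth_rewrite 1 [eq_deviation_add (rhoB ψ)]
    rw [Matrix.add_kronecker, Matrix.kronecker_add, Matrix.smul_kronecker, Matrix.kronecker_smul,
      Matrix.one_kronecker_one]
    module
  have hTT := sum_mul_sum hA hB
  rw [← hT] at hTT
  have hT0 : T.trace = 0 := by
    simp [hT, Matrix.trace_add, Matrix.trace_kronecker, hA, hB]
  have hT2 : (T * T).trace = 2 * ((deviation (rhoA ψ) * deviation (rhoA ψ)).trace
      + (deviation (rhoB ψ) * deviation (rhoB ψ)).trace) := by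
    rw [hTT]
    simp [Matrix.trace_add, Matrix.trace_kronecker, hA]
    ring
  have hT3 : (T * T * T).trace = 0 := by
    rw [hTT, add_mul, Matrix.trace_add, smul_mul_assoc, one_mul, Matrix.trace_smul, hT0, hT]
    simp [mul_add, ← Matrix.mul_kronecker_mul, Matrix.trace_kronecker, Matrix.trace_add, hA, hB]
  have hPT := trace_rhoAB_mul_sum hψ
  rw [← hT] at hPT
  have hPTT : (rhoAB ψ * (T * T)).trace = ((deviation (rhoA ψ) * deviation (rhoA ψ)).trace
      + (deviation (rhoB ψ) * deviation (rhoB ψ)).trace) / 2 + 2 * corrAB ψ := by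
    rw [hTT, mul_add, Matrix.trace_add, mul_smul_comm, mul_one, Matrix.trace_smul,
      trace_rhoAB hψ, mul_smul_comm, Matrix.trace_smul, corrAB]
    simp
  have hPPT := trace_rhoAB_mul_self_mul ψ T
  rw [hPT] at hPPT
  have hC : corrC ψ T = corrC ψ (deviation (rhoA ψ) ⊗ₖ 1) + corrC ψ (1 ⊗ₖ deviation (rhoB ψ)) := by
    simp only [corrC, hT, Matrix.mul_add, Matrix.add_mul, Matrix.trace_add]
  have hPP := (trace_rhoAB_mul_self ψ).trans (trace_mul_self_eq (trace_gramC hψ))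
  have hPPP := (trace_rhoAB_mul_self_mul_self ψ).trans
    (trace_mul_self_mul_self_eq (trace_gramC hψ))
  rw [hS, trace_one_add_add_pow_three]
  simp only [smul_mul_assoc, mul_smul_comm, Matrix.trace_smul, smul_eq_mul, sq, hT0, hT2, hT3,
    hPT, hPTT, hPPT, hC, hPP, hPPP, trace_rhoAB hψ, Matrix.trace_one, Fintype.card_prod,
    Fintype.card_fin]
  push_cast
  ring

/-! ### Positivity bounds on the correlators -/

open scoped ComplexOrder in
theorem re_trace_conjTranspose_mul_self_nonneg {m n : Type*} [Fintype m] [Fintype n]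
    (X : Matrix m n ℂ) : 0 ≤ (Xᴴ * X).trace.re := by
  classical
  exact (Complex.le_def.mp (Matrix.posSemidef_conjTranspose_mul_self X).trace_nonneg).1

/-- Expectation of `T²` for `T = α ⊗ 1 + 1 ⊗ β`: by `sum_mul_sum` it equals `(a+b)/2` plus twice the
correlator. -/
theorem re_corrAB_ge (hψ : ‖ψ‖ = 1) :
    0 ≤ (deviation (rhoA ψ) * deviation (rhoA ψ)).trace.re
      + (deviation (rhoB ψ) * deviation (rhoB ψ)).trace.re + 4 * (corrAB ψ).re := by
  have hA := trace_deviation (trace_rhoA hψ)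
  have hB := trace_deviation (trace_rhoB hψ)
  set T := deviation (rhoA ψ) ⊗ₖ (1 : Matrix (Fin 2) (Fin 2) ℂ)
      + (1 : Matrix (Fin 2) (Fin 2) ℂ) ⊗ₖ deviation (rhoB ψ) with hT
  have hTT := sum_mul_sum hA hB
  rw [← hT] at hTT
  have hTh : Tᴴ = T := by
    simp [hT, Matrix.conjTranspose_kronecker, (deviation_isHermitian (rhoA_isHermitian ψ)).eq,
      (deviation_isHermitian (rhoB_isHermitian ψ)).eq]
  have h := re_trace_conjTranspose_mul_self_nonneg (T * coeffAB ψ)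
  rw [Matrix.conjTranspose_mul, hTh, Matrix.mul_assoc, Matrix.trace_mul_comm,
    ← Matrix.mul_assoc, Matrix.mul_assoc, ← rhoAB_eq_mul, Matrix.trace_mul_comm, hTT, mul_add,
    Matrix.trace_add, mul_smul_comm, mul_one, Matrix.trace_smul,
    trace_rhoAB hψ, mul_smul_comm, Matrix.trace_smul, ← corrAB] at h
  simp at h
  linarith

/-- Same argument for an operator on AB and the deviation on C, which act from the left and the
right on the coefficient matrix. The two squares are scalar and the two cross terms coincide. -/
theorem re_corrC_ge (hψ : ‖ψ‖ = 1) {X : Matrix (Fin 2 × Fin 2) (Fin 2 × Fin 2) ℂ} {t : ℂ}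
    (hX : X.IsHermitian) (hXX : X * X = (t / 2) • 1) :
    0 ≤ t.re + (deviation (gramC ψ) * deviation (gramC ψ)).trace.re + 4 * (corrC ψ X).re := by
  have hK := trace_deviation (trace_gramC hψ)
  have hKh := (deviation_isHermitian (gramC_isHermitian ψ)).eq
  have hKK := mul_self_of_trace_eq_zero hK
  have h := re_trace_conjTranspose_mul_self_nonneg
    (X * coeffAB ψ + coeffAB ψ * deviation (gramC ψ))
  have e1 : ((coeffAB ψ)ᴴ * X * (X * coeffAB ψ)).trace = t / 2 := by
    rw [Matrix.mul_assoc, ← Matrix.mul_assoc X, hXX]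
    rw [Matrix.smul_mul, Matrix.one_mul, Matrix.mul_smul, ← gramC, Matrix.trace_smul,
      trace_gramC hψ, smul_eq_mul, mul_one]
  have e2 : (deviation (gramC ψ) * (coeffAB ψ)ᴴ * (X * coeffAB ψ)).trace = corrC ψ X := by
    rw [Matrix.mul_assoc, Matrix.trace_mul_comm, corrC]
    simp only [Matrix.mul_assoc]
  have e3 : ((coeffAB ψ)ᴴ * X * (coeffAB ψ * deviation (gramC ψ))).trace = corrC ψ X := by
    simp only [corrC, Matrix.mul_assoc]
  have e4 : (deviation (gramC ψ) * (coeffAB ψ)ᴴ * (coeffAB ψ * deviation (gramC ψ))).trace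
      = (deviation (gramC ψ) * deviation (gramC ψ)).trace / 2 := by
    rw [Matrix.mul_assoc, ← Matrix.mul_assoc (coeffAB ψ)ᴴ, ← gramC, Matrix.trace_mul_comm,
      Matrix.mul_assoc, hKK, Matrix.mul_smul, Matrix.trace_smul, mul_one, trace_gramC hψ]
    simp
  rw [Matrix.conjTranspose_add, Matrix.conjTranspose_mul, Matrix.conjTranspose_mul, hX.eq, hKh,
    Matrix.add_mul, Matrix.mul_add, Matrix.mul_add, Matrix.trace_add, Matrix.trace_add,
    Matrix.trace_add, e1, e2, e3, e4] at h
  simp at h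
  linarith

/-- Each deviation enters two of the three correlators, so 12 times their sum costs at most 6 of the
27, leaving 21. -/
theorem phi_le (hψ : ‖ψ‖ = 1) :
    phi ψ ≤ 99 / 2 - 21 * ((deviation (rhoA ψ) * deviation (rhoA ψ)).trace.re
      + (deviation (rhoB ψ) * deviation (rhoB ψ)).trace.re
      + (deviation (gramC ψ) * deviation (gramC ψ)).trace.re) := by
  have h := congrArg Complex.re (trace_sumOp_pow_add hψ)
  have h1 := re_corrAB_ge hψ
  have h2 := re_corrC_ge hψ (X := deviation (rhoA ψ) ⊗ₖ 1)
    (t := (deviation (rhoA ψ) * deviation (rhoA ψ)).trace)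
    (by simp [Matrix.IsHermitian, Matrix.conjTranspose_kronecker,
          (deviation_isHermitian (rhoA_isHermitian ψ)).eq])
    (by rw [← Matrix.mul_kronecker_mul, mul_one,
          mul_self_of_trace_eq_zero (trace_deviation (trace_rhoA hψ)), Matrix.smul_kronecker,
          Matrix.one_kronecker_one]
        simp)
  have h3 := re_corrC_ge hψ (X := 1 ⊗ₖ deviation (rhoB ψ))
    (t := (deviation (rhoB ψ) * deviation (rhoB ψ)).trace)
    (by simp [Matrix.IsHermitian, Matrix.conjTranspose_kronecker,
          (deviation_isHermitian (rhoB_isHermitian ψ)).eq])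
    (by rw [← Matrix.mul_kronecker_mul, mul_one,
          mul_self_of_trace_eq_zero (trace_deviation (trace_rhoB hψ)), Matrix.kronecker_smul,
          Matrix.one_kronecker_one]
        simp)
  simp at h
  rw [phi]
  linarith

end Trace

/-! ### Equality and maximally mixed marginals -/

/-- All three one-qubit marginals of `ψ` are maximally mixed. -/
def MaximallyMixedMarginals (ψ : Space) : Prop :=
  rhoA ψ = (1 / 2 : ℂ) • 1 ∧ rhoB ψ = (1 / 2 : ℂ) • 1 ∧ gramC ψ = (1 / 2 : ℂ) • 1

theorem deviation_eq_zero_iff {X : Matrix (Fin 2) (Fin 2) ℂ} :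
    deviation X = 0 ↔ X = (1 / 2 : ℂ) • 1 := sub_eq_zero

theorem re_trace_deviation_nonneg {X : Matrix (Fin 2) (Fin 2) ℂ} (h : X.IsHermitian) :
    0 ≤ (deviation X * deviation X).trace.re := by
  have := re_trace_conjTranspose_mul_self_nonneg (deviation X)
  rwa [(deviation_isHermitian h).eq] at this

open scoped ComplexOrder in
theorem eq_of_re_trace_deviation_eq_zero {X : Matrix (Fin 2) (Fin 2) ℂ} (h : X.IsHermitian)
    (h0 : (deviation X * deviation X).trace.re = 0) : X = (1 / 2 : ℂ) • 1 := by
  have hd := deviation_isHermitian h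
  rw [← deviation_eq_zero_iff, ← Matrix.trace_conjTranspose_mul_self_eq_zero_iff, hd.eq,
    ← ofReal_re_trace (M := deviation X * deviation X) (by simpa [sq] using hd.pow 2), h0]
  simp

theorem phi_le_and_eq_iff {ψ : Space} (hψ : ‖ψ‖ = 1) :
    phi ψ ≤ 99 / 2 ∧ (phi ψ = 99 / 2 ↔ MaximallyMixedMarginals ψ) := by
  have h := phi_le hψ
  have hA := re_trace_deviation_nonneg (rhoA_isHermitian ψ)
  have hB := re_trace_deviation_nonneg (rhoB_isHermitian ψ)
  have hC := re_trace_deviation_nonneg (gramC_isHermitian ψ)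
  refine ⟨by linarith, fun he => ?_, fun ⟨h1, h2, h3⟩ => ?_⟩
  · exact ⟨eq_of_re_trace_deviation_eq_zero (rhoA_isHermitian ψ) (by linarith),
      eq_of_re_trace_deviation_eq_zero (rhoB_isHermitian ψ) (by linarith),
      eq_of_re_trace_deviation_eq_zero (gramC_isHermitian ψ) (by linarith)⟩
  · have e := trace_sumOp_pow_add hψ
    rw [corrAB, corrC, corrC, deviation_eq_zero_iff.mpr h1, deviation_eq_zero_iff.mpr h2,
      deviation_eq_zero_iff.mpr h3] at e
    have e' := congrArg Complex.re e
    simp at e'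
    rw [phi]
    linarith

/-! ### Local unitaries and invariance of the marginal condition -/

/-- The action of the local operator `U ⊗ V ⊗ W`. -/
noncomputable def act (U V W : Matrix (Fin 2) (Fin 2) ℂ) (ψ : Space) : Space :=
  WithLp.toLp 2 ((U ⊗ₖ (V ⊗ₖ W)) *ᵥ ψ.ofLp)

theorem act_apply (U V W : Matrix (Fin 2) (Fin 2) ℂ) (ψ : Space) (x : Fin 2 × Fin 2 × Fin 2) :
    act U V W ψ x = ∑ i, ∑ j, ∑ k, U x.1 i * (V x.2.1 j * W x.2.2 k) * ψ (i, j, k) := by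
  simp only [act, Matrix.mulVec, dotProduct, Fintype.sum_prod_type, Matrix.kroneckerMap_apply]

theorem act_act (U V W U' V' W' : Matrix (Fin 2) (Fin 2) ℂ) (ψ : Space) :
    act U V W (act U' V' W' ψ) = act (U * U') (V * V') (W * W') ψ := by
  simp only [act, Matrix.mulVec_mulVec, ← Matrix.mul_kronecker_mul]

theorem act_one (ψ : Space) : act 1 1 1 ψ = ψ := by
  simp [act]

theorem LUEquiv.act_left {U V W : Matrix (Fin 2) (Fin 2) ℂ} {ψ χ : Space}
    (hU : U ∈ Matrix.unitaryGroup (Fin 2) ℂ) (hV : V ∈ Matrix.unitaryGroup (Fin 2) ℂ)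
    (hW : W ∈ Matrix.unitaryGroup (Fin 2) ℂ) (h : LUEquiv (act U V W ψ) χ) : LUEquiv ψ χ := by
  obtain ⟨U', hU', V', hV', W', hW', e⟩ := h
  refine ⟨star U * U', mul_mem (Unitary.star_mem hU) hU', star V * V', mul_mem (Unitary.star_mem hV) hV',
    star W * W', mul_mem (Unitary.star_mem hW) hW', ?_⟩
  change _ = act _ _ _ χ
  change _ = act _ _ _ χ at e
  rw [← act_act, ← e, act_act, (Matrix.mem_unitaryGroup_iff').mp hU,
    (Matrix.mem_unitaryGroup_iff').mp hV, (Matrix.mem_unitaryGroup_iff').mp hW, act_one]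

/-- The coefficients of `ψ` with rows indexed by qubit `A`. -/
noncomputable def coeffA (ψ : Space) : Matrix (Fin 2) (Fin 2 × Fin 2) ℂ :=
  Matrix.of fun a x => ψ (a, x.1, x.2)

/-- The coefficients of `ψ` with rows indexed by qubit `B`. -/
noncomputable def coeffB (ψ : Space) : Matrix (Fin 2) (Fin 2 × Fin 2) ℂ :=
  Matrix.of fun b x => ψ (x.1, b, x.2)

theorem rhoA_eq_mul (ψ : Space) : rhoA ψ = coeffA ψ * (coeffA ψ)ᴴ := by
  ext x y
  simp [rhoA, rhoAB, rhoABC, coeffA, Matrix.mul_apply, Fintype.sum_prod_type]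

theorem rhoB_eq_mul (ψ : Space) : rhoB ψ = coeffB ψ * (coeffB ψ)ᴴ := by
  ext x y
  simp [rhoB, rhoAB, rhoABC, coeffB, Matrix.mul_apply, Fintype.sum_prod_type]

section Action

variable (U V W : Matrix (Fin 2) (Fin 2) ℂ) (ψ : Space)

theorem coeffA_act : coeffA (act U V W ψ) = U * coeffA ψ * (V ⊗ₖ W)ᵀ := by
  ext x y
  simp [coeffA, act_apply, Matrix.mul_apply, Fintype.sum_prod_type]
  ring

theorem coeffB_act : coeffB (act U V W ψ) = V * coeffB ψ * (U ⊗ₖ W)ᵀ := by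
  ext x y
  simp [coeffB, act_apply, Matrix.mul_apply, Fintype.sum_prod_type]
  ring

theorem coeffAB_act : coeffAB (act U V W ψ) = (U ⊗ₖ V) * coeffAB ψ * Wᵀ := by
  ext x y
  simp [coeffAB, act_apply, Matrix.mul_apply, Fintype.sum_prod_type]
  ring

end Action

theorem transpose_mul_conjTranspose_transpose {n : Type*} [Fintype n] [DecidableEq n]
    {U : Matrix n n ℂ} (h : U ∈ Matrix.unitaryGroup n ℂ) : Uᵀ * Uᵀᴴ = 1 := by
  have h' := congrArg Matrix.transpose ((Matrix.mem_unitaryGroup_iff').mp h)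
  rwa [Matrix.transpose_mul, Matrix.transpose_one] at h'

theorem conj_smul_one {m n : Type*} [Fintype m] [DecidableEq m] [Fintype n] [DecidableEq n]
    {U : Matrix m m ℂ} {V : Matrix n n ℂ} {M : Matrix m n ℂ} {t : ℂ}
    (hU : U ∈ Matrix.unitaryGroup m ℂ) (hV : V ∈ Matrix.unitaryGroup n ℂ)
    (hM : M * Mᴴ = t • 1) : (U * M * Vᵀ) * (U * M * Vᵀ)ᴴ = t • 1 := by
  have e : (U * M * Vᵀ) * (U * M * Vᵀ)ᴴ = U * (M * (Vᵀ * Vᵀᴴ) * Mᴴ) * Uᴴ := by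
    simp only [Matrix.conjTranspose_mul, Matrix.mul_assoc]
  rw [e, transpose_mul_conjTranspose_transpose hV, Matrix.mul_one, hM, Matrix.mul_smul,
    Matrix.mul_one, Matrix.smul_mul]
  exact congrArg _ ((Matrix.mem_unitaryGroup_iff).mp hU)

theorem conjTranspose_conj_smul_one {m n : Type*} [Fintype m] [DecidableEq m] [Fintype n]
    [DecidableEq n] {U : Matrix m m ℂ} {V : Matrix n n ℂ} {M : Matrix m n ℂ} {t : ℂ}
    (hU : U ∈ Matrix.unitaryGroup m ℂ) (hV : V ∈ Matrix.unitaryGroup n ℂ)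
    (hM : Mᴴ * M = t • 1) : (U * M * Vᵀ)ᴴ * (U * M * Vᵀ) = t • 1 := by
  have e : (U * M * Vᵀ)ᴴ * (U * M * Vᵀ) = Vᵀᴴ * (Mᴴ * (Uᴴ * U) * M) * Vᵀ := by
    simp only [Matrix.conjTranspose_mul, Matrix.mul_assoc]
  have hU' : Uᴴ * U = 1 := (Matrix.mem_unitaryGroup_iff').mp hU
  rw [e, hU', Matrix.mul_one, hM, Matrix.mul_smul, Matrix.mul_one, Matrix.smul_mul,
    mul_eq_one_comm.mp (transpose_mul_conjTranspose_transpose hV)]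

theorem MaximallyMixedMarginals.map_act {U V W : Matrix (Fin 2) (Fin 2) ℂ} {ψ : Space}
    (hU : U ∈ Matrix.unitaryGroup (Fin 2) ℂ) (hV : V ∈ Matrix.unitaryGroup (Fin 2) ℂ)
    (hW : W ∈ Matrix.unitaryGroup (Fin 2) ℂ) (h : MaximallyMixedMarginals ψ) :
    MaximallyMixedMarginals (act U V W ψ) := by
  obtain ⟨hA, hB, hC⟩ := h
  rw [rhoA_eq_mul] at hA
  rw [rhoB_eq_mul] at hB
  rw [gramC] at hC
  rw [MaximallyMixedMarginals, rhoA_eq_mul, rhoB_eq_mul, gramC, coeffA_act, coeffB_act,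
    coeffAB_act]
  exact ⟨conj_smul_one hU (Matrix.kronecker_mem_unitary hV hW) hA,
    conj_smul_one hV (Matrix.kronecker_mem_unitary hU hW) hB,
    conjTranspose_conj_smul_one (Matrix.kronecker_mem_unitary hU hV) hW hC⟩

theorem ghz_apply (x : Fin 2 × Fin 2 × Fin 2) :
    ghz x = if x = (0, 0, 0) ∨ x = (1, 1, 1) then ((1 / Real.sqrt 2 : ℝ) : ℂ) else 0 := by
  obtain ⟨i, j, k⟩ := x
  fin_cases i <;> fin_cases j <;> fin_cases k <;> simp [ghz, ket]

theorem inv_sqrt_two_mul_self :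
    ((Real.sqrt 2 : ℝ) : ℂ)⁻¹ * ((Real.sqrt 2 : ℝ) : ℂ)⁻¹ = 2⁻¹ := by
  rw [← mul_inv, ← Complex.ofReal_mul, Real.mul_self_sqrt (by norm_num)]
  simp

theorem maximallyMixedMarginals_ghz : MaximallyMixedMarginals ghz := by
  refine ⟨?_, ?_, ?_⟩ <;> ext i j <;> fin_cases i <;> fin_cases j <;>
    simp [rhoA, rhoB, gramC, coeffAB, rhoAB, rhoABC, ghz_apply, Matrix.mul_apply,
      Fintype.sum_prod_type, inv_sqrt_two_mul_self]

/-! ### Reduction to GHZ by local unitaries -/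

/-- The unitary with first row `(x, y)`. -/
noncomputable def rotation (x y : ℂ) : Matrix (Fin 2) (Fin 2) ℂ :=
  !![x, y; -star y, star x]

theorem rotation_mem {x y : ℂ} (h : x * star x + y * star y = 1) :
    rotation x y ∈ Matrix.unitaryGroup (Fin 2) ℂ := by
  rw [Matrix.mem_unitaryGroup_iff]
  simp only [Complex.star_def] at h
  ext i j
  fin_cases i <;> fin_cases j <;>
    simp [rotation, Matrix.mul_apply, Fin.sum_univ_two, Matrix.star_apply] <;>
    first | linear_combination h | ring

theorem exists_smul_normalized {x y : ℂ} (h : x ≠ 0 ∨ y ≠ 0) :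
    ∃ t : ℂ, (t * x) * star (t * x) + (t * y) * star (t * y) = 1 := by
  have hpos : 0 < Complex.normSq x + Complex.normSq y := by
    rcases h with h | h
    · have := Complex.normSq_pos.mpr h
      have := Complex.normSq_nonneg y
      linarith
    · have := Complex.normSq_pos.mpr h
      have := Complex.normSq_nonneg x
      linarith
  set s := Complex.normSq x + Complex.normSq y with hs
  refine ⟨((Real.sqrt s)⁻¹ : ℝ), ?_⟩
  simp only [Complex.star_def, Complex.mul_conj, Complex.normSq_mul, Complex.normSq_ofReal]
  rw [← Complex.ofReal_add, ← mul_add, ← hs, ← mul_inv, Real.mul_self_sqrt hpos.le,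
    inv_mul_cancel₀ hpos.ne', Complex.ofReal_one]

theorem exists_normalized_root (p q r : ℂ) :
    ∃ x y : ℂ, x * star x + y * star y = 1 ∧ p * x ^ 2 + q * x * y + r * y ^ 2 = 0 := by
  obtain ⟨x, y, hxy, h⟩ : ∃ x y : ℂ, (x ≠ 0 ∨ y ≠ 0) ∧ p * x ^ 2 + q * x * y + r * y ^ 2 = 0 := by
    by_cases hp : p = 0
    -- The root at infinity, also covering the zero form.
    · exact ⟨1, 0, by simp, by simp [hp]⟩
    · obtain ⟨s, hs⟩ := IsAlgClosed.exists_pow_nat_eq (discrim p q r) (n := 2) (by norm_num)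
      obtain ⟨x, hx⟩ := exists_quadratic_eq_zero hp ⟨s, by rw [← hs, sq]⟩
      exact ⟨x, 1, by simp, by linear_combination hx⟩
  obtain ⟨t, ht⟩ := exists_smul_normalized hxy
  exact ⟨t * x, t * y, ht, by linear_combination t ^ 2 * h⟩

theorem exists_unitary_mulVec_eq_zero {N : Matrix (Fin 2) (Fin 2) ℂ} (h : N.det = 0) :
    ∃ W ∈ Matrix.unitaryGroup (Fin 2) ℂ, ∀ j, N j 0 * W 1 0 + N j 1 * W 1 1 = 0 := by
  obtain ⟨v, hv, hN⟩ := Matrix.exists_mulVec_eq_zero_iff.mpr h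
  have hv' : star (v 1) ≠ 0 ∨ star (v 0) ≠ 0 := by
    by_contra! hc
    refine hv (funext fun i => ?_)
    fin_cases i
    · simpa using hc.2
    · simpa using hc.1
  obtain ⟨t, ht⟩ := exists_smul_normalized hv'
  -- The entries are chosen so that the second row is `star t` times the kernel vector `v`.
  refine ⟨rotation (t * star (v 1)) (-(t * star (v 0))), rotation_mem (by simpa using ht),
    fun j => ?_⟩
  have hj := congrFun hN j
  simp [Matrix.mulVec, dotProduct, Fin.sum_univ_two] at hj
  simp [rotation]
  linear_combination (starRingEnd ℂ t) * hj

/-- A right kernel vector as second row of `W` kills the second column; a left kernel vector as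
second row of `V` kills the second row. -/
theorem exists_unitary_diagonalize_singular {N : Matrix (Fin 2) (Fin 2) ℂ} (h : N.det = 0) :
    ∃ V ∈ Matrix.unitaryGroup (Fin 2) ℂ, ∃ W ∈ Matrix.unitaryGroup (Fin 2) ℂ,
      ∀ j k, j ≠ 0 ∨ k ≠ 0 → (V * N * Wᵀ) j k = 0 := by
  obtain ⟨W, hW, hNW⟩ := exists_unitary_mulVec_eq_zero h
  obtain ⟨V, hV, hNV⟩ := exists_unitary_mulVec_eq_zero (N := Nᵀ) (by rwa [Matrix.det_transpose])
  simp only [Matrix.transpose_apply] at hNV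
  refine ⟨V, hV, W, hW, fun j k hjk => ?_⟩
  have hk : ∀ j, (V * N * Wᵀ) j 1 = 0 := fun j => by
    simp only [Matrix.mul_apply, Fin.sum_univ_two, Matrix.transpose_apply]
    linear_combination V j 0 * hNW 0 + V j 1 * hNW 1
  have hj : ∀ k, (V * N * Wᵀ) 1 k = 0 := fun k => by
    simp only [Matrix.mul_apply, Fin.sum_univ_two, Matrix.transpose_apply]
    linear_combination W k 0 * hNV 0 + W k 1 * hNV 1
  rcases hjk with h | h
  · rw [Fin.eq_one_of_ne_zero j h, hj]
  · rw [Fin.eq_one_of_ne_zero k h, hk]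

/-- The operator on qubits `B` and `C` obtained by fixing qubit `A` to `|0⟩`. -/
noncomputable def slice (ψ : Space) : Matrix (Fin 2) (Fin 2) ℂ :=
  Matrix.of fun j k => ψ (0, j, k)

theorem slice_act_one_left (V W : Matrix (Fin 2) (Fin 2) ℂ) (ψ : Space) :
    slice (act 1 V W ψ) = V * slice ψ * Wᵀ := by
  ext j k
  simp [slice, act_apply, Matrix.mul_apply]
  ring

theorem exists_unitary_det_slice_eq_zero (ψ : Space) :
    ∃ U ∈ Matrix.unitaryGroup (Fin 2) ℂ, (slice (act U 1 1 ψ)).det = 0 := by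
  -- The coefficients of `det (x N₀ + y N₁)`, where `N₀`, `N₁` are the slices of `ψ` at `|0⟩` and
  -- `|1⟩` of A.
  obtain ⟨x, y, hxy, h⟩ := exists_normalized_root
    (ψ (0, 0, 0) * ψ (0, 1, 1) - ψ (0, 0, 1) * ψ (0, 1, 0))
    (ψ (0, 0, 0) * ψ (1, 1, 1) + ψ (1, 0, 0) * ψ (0, 1, 1)
      - ψ (0, 0, 1) * ψ (1, 1, 0) - ψ (1, 0, 1) * ψ (0, 1, 0))
    (ψ (1, 0, 0) * ψ (1, 1, 1) - ψ (1, 0, 1) * ψ (1, 1, 0))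
  refine ⟨rotation x y, rotation_mem hxy, ?_⟩
  simp [Matrix.det_fin_two, slice, act_apply, rotation, Matrix.one_apply]
  linear_combination h

theorem exists_sqrt_two_mul_unit {z : ℂ} (h : z * star z = 1 / 2) :
    ∃ u : ℂ, u * star u = 1 ∧ z = u * ((Real.sqrt 2 : ℝ) : ℂ)⁻¹ := by
  have h2 : ((Real.sqrt 2 : ℝ) : ℂ) ≠ 0 := by simp
  have h3 : ((Real.sqrt 2 : ℝ) : ℂ) * ((Real.sqrt 2 : ℝ) : ℂ) = 2 := by
    rw [← Complex.ofReal_mul, Real.mul_self_sqrt (by norm_num)]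
    simp
  refine ⟨z * ((Real.sqrt 2 : ℝ) : ℂ), ?_, by field_simp⟩
  rw [star_mul', Complex.star_def, Complex.conj_ofReal]
  rw [Complex.star_def] at h
  linear_combination 2 * h + z * (starRingEnd ℂ) z * h3

theorem eq_zero_of_mul_star_add_eq_zero {x y : ℂ} (h : x * star x + y * star y = 0) :
    x = 0 ∧ y = 0 := by
  simp only [Complex.star_def, Complex.mul_conj, ← Complex.ofReal_add] at h
  have h' : Complex.normSq x + Complex.normSq y = 0 := by exact_mod_cast h
  have h1 := Complex.normSq_nonneg x
  have h2 := Complex.normSq_nonneg y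
  exact ⟨Complex.normSq_eq_zero.mp (by linarith), Complex.normSq_eq_zero.mp (by linarith)⟩

/-- A state with maximally mixed marginals whose `|0⟩`-slice is a multiple of `|00⟩` is
LU-equivalent to GHZ. -/
theorem MaximallyMixedMarginals.luEquiv_of_slice {ψ : Space} (h : MaximallyMixedMarginals ψ)
    (hs : ∀ j k, j ≠ 0 ∨ k ≠ 0 → slice ψ j k = 0) : LUEquiv ψ ghz := by
  obtain ⟨hA, hB, hC⟩ := h
  have h001 : ψ (0, 0, 1) = 0 := hs 0 1 (by simp)
  have h010 : ψ (0, 1, 0) = 0 := hs 1 0 (by simp)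
  have h011 : ψ (0, 1, 1) = 0 := hs 1 1 (by simp)
  have hA00 := congrFun (congrFun hA 0) 0
  have hA11 := congrFun (congrFun hA 1) 1
  have hB00 := congrFun (congrFun hB 0) 0
  have hC00 := congrFun (congrFun hC 0) 0
  simp [rhoA, rhoB, rhoAB, rhoABC, gramC, coeffAB, Matrix.mul_apply, Fintype.sum_prod_type,
    h001, h010, h011] at hA00 hA11 hB00 hC00
  -- The amplitude of `|000⟩` already has weight 1/2, which exhausts the `|0⟩` population of B and,
  -- below, of C.
  obtain ⟨h100, h101⟩ := eq_zero_of_mul_star_add_eq_zero (x := ψ (1, 0, 0)) (y := ψ (1, 0, 1))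
    (by simp only [Complex.star_def]; linear_combination hB00 - hA00)
  obtain ⟨-, h110⟩ := eq_zero_of_mul_star_add_eq_zero (x := ψ (1, 0, 0)) (y := ψ (1, 1, 0))
    (by simp only [Complex.star_def]; linear_combination hC00 - hA00)
  simp [h100, h101, h110] at hA11
  obtain ⟨u, hu, hu'⟩ := exists_sqrt_two_mul_unit (z := ψ (0, 0, 0)) (by simpa using hA00)
  obtain ⟨v, hv, hv'⟩ := exists_sqrt_two_mul_unit (z := ψ (1, 1, 1)) (by simpa using hA11)
  -- Only the phases of the two surviving amplitudes remain; a diagonal unitary on A supplies both.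
  refine ⟨Matrix.diagonal ![u, v], ?_, 1, one_mem _, 1, one_mem _, ?_⟩
  · rw [Matrix.mem_unitaryGroup_iff, Matrix.star_eq_conjTranspose, Matrix.diagonal_conjTranspose,
      Matrix.diagonal_mul_diagonal, ← Matrix.diagonal_one]
    congr 1
    ext i
    fin_cases i
    · simpa using hu
    · simpa using hv
  · change ψ = act _ _ _ ghz
    ext ⟨i, j, k⟩
    rw [act_apply]
    fin_cases i <;> fin_cases j <;> fin_cases k <;>
      simp [ghz_apply, Matrix.one_apply, h001, h010, h011, h100, h101, h110, hu', hv']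

theorem MaximallyMixedMarginals.luEquiv_ghz {ψ : Space} (h : MaximallyMixedMarginals ψ) :
    LUEquiv ψ ghz := by
  obtain ⟨U, hU, hdet⟩ := exists_unitary_det_slice_eq_zero ψ
  obtain ⟨V, hV, W, hW, hs⟩ := exists_unitary_diagonalize_singular hdet
  rw [← slice_act_one_left] at hs
  exact (((h.map_act hU (one_mem _) (one_mem _)).map_act (one_mem _) hV hW).luEquiv_of_slice hs).act_left
    (one_mem _) hV hW |>.act_left hU (one_mem _) (one_mem _)

theorem maximallyMixedMarginals_iff_luEquiv_ghz (ψ : Space) :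
    MaximallyMixedMarginals ψ ↔ LUEquiv ψ ghz := by
  refine ⟨fun h => h.luEquiv_ghz, ?_⟩
  rintro ⟨U, hU, V, hV, W, hW, rfl⟩
  exact maximallyMixedMarginals_ghz.map_act hU hV hW

end ThreeQubit

theorem proposition9 (ψ : ThreeQubit.Space) (hψ : ‖ψ‖ = 1) :
    ThreeQubit.phi ψ ≤ 99 / 2 ∧
      (ThreeQubit.phi ψ = 99 / 2 ↔ ThreeQubit.LUEquiv ψ ThreeQubit.ghz) := by
  rw [← ThreeQubit.maximallyMixedMarginals_iff_luEquiv_ghz]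
  exact ThreeQubit.phi_le_and_eq_iff hψ
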